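/- For $\sigma>0$ let $B_\sigma$ be the space of all $f\in L^2(\mathbb{R})$ (complex valued) whose Fourier transform $\widehat f(\xi)=\int_{-\infty}^{\infty} f(x)e^{-ix\xi}\,dx$ has its support in $[-\sigma,\sigma]$; each such $f$ is identified with its continuous (in fact entire) representative. A point $x\in\mathbb{R}$ is called a double zero of $f$ if $f(x)=f'(x)=0$. Let $\tau$ be the smallest positive root of the equation $$\tanh\Big(\frac{\pi\tau^{1/4}}{2}\Big)+\tan\Big(\frac{\pi\tau^{1/4}}{2}\Big)=0 ;$$ this root exists, and $|\tau-5.0625|<\tfrac1{10}$ (more precisely $\tau\approx 5.139$, $\tau^{1/4}\approx 1.506$). Let $\sigma>0$ and let $f\in B_\sigma$ be non-zero. If $f$ has infinitely many double zeros on the real line, then there are two consecutive double zeros $a<b$ of $f$ (that is, $f$ has no double zero in the open interval $(a,b)$) with $$b-a>\frac{\pi}{\sigma}\,\tau^{1/4}.$$ -/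

import Mathlib

open MeasureTheory
open scoped FourierTransform

noncomputable section

/-- The Fourier(-Plancherel) transform on `L²(ℝ)` in the angular-frequency normalisation, that is,
the extension to `L²` of `f ↦ ∫ f(x) exp(-i x ξ) dx`. Mathlib's `𝓕` has the kernel
`exp(-2 π i x ξ)`, whence the rescaling. It is determined up to almost everywhere equality. -/
def angularFourier (F : Lp ℂ 2 (volume : Measure ℝ)) (ξ : ℝ) : ℂ :=
  (𝓕 F : Lp ℂ 2 (volume : Measure ℝ)) (ξ / (2 * Real.pi))

/-- The space `B_σ` of `σ`-band limited functions: the (classes of) functions in `L²(ℝ)` whose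
Fourier transform has its (essential) support in `[-σ, σ]`. -/
def bandLimited (σ : ℝ) : Set (Lp ℂ 2 (volume : Measure ℝ)) :=
  {F | ∀ᵐ ξ ∂(volume : Measure ℝ), ξ ∉ Set.Icc (-σ) σ → angularFourier F ξ = 0}

/-- The points at which `f` has a double zero, i.e. `f` and its derivative both vanish. -/
def doubleZeros (f : ℝ → ℂ) : Set ℝ :=
  {x | f x = 0 ∧ HasDerivAt f 0 x}

/-- `a < b` are two consecutive elements of `Z`. -/
def AreConsecutive (Z : Set ℝ) (a b : ℝ) : Prop :=
  a ∈ Z ∧ b ∈ Z ∧ a < b ∧ ∀ x ∈ Z, ¬ (a < x ∧ x < b)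

/-- The positive roots `t` of `tanh (π t^{1/4} / 2) + tan (π t^{1/4} / 2) = 0`. -/
def beamRoots : Set ℝ :=
  {t | 0 < t ∧
    Real.tanh (Real.pi * t ^ (1 / 4 : ℝ) / 2) + Real.tan (Real.pi * t ^ (1 / 4 : ℝ) / 2) = 0}

end

open Real in
theorem tanh_strictMono : StrictMono Real.tanh := by
  intro x y h
  rw [Real.tanh_eq_sinh_div_cosh, Real.tanh_eq_sinh_div_cosh,
    div_lt_div_iff₀ (Real.cosh_pos x) (Real.cosh_pos y)]
  have := Real.sinh_pos_iff.2 (sub_pos.2 h)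
  rw [Real.sinh_sub] at this
  linarith

open Real in
theorem strictMonoOn_tanh_add_tan :
    StrictMonoOn (fun s : ℝ => tanh s + tan s) (Set.Ioo (π / 2) π) := by
  intro x hx y hy h
  have h1 := tanh_strictMono h
  have h2 : tan (x - π) < tan (y - π) :=
    tan_lt_tan_of_lt_of_lt_pi_div_two (by linarith [hx.1]) (by linarith [hy.2, pi_pos])
      (by linarith)
  rw [tan_sub_pi, tan_sub_pi] at h2
  exact add_lt_add h1 h2

open Real in
theorem tanh_add_tan_pos_of_le {s : ℝ} (h0 : 0 < s) (h1 : s ≤ π / 2) : 0 < tanh s + tan s := by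
  have h2 : 0 < tanh s := by simpa using tanh_strictMono h0
  rcases h1.eq_or_lt with rfl | h1
  · simpa using h2
  · exact add_pos h2 (tan_pos_of_pos_of_lt_pi_div_two h0 h1)

open Real in
theorem tanh_add_tan_pos_right : 0 < tanh (π * 1.507 / 2) + tan (π * 1.507 / 2) := by
  have hpi := pi_gt_d2
  have hpi' := pi_lt_d2
  set d : ℝ := π * 0.0035 with hd
  have hd1 : 0.0109 < d := by rw [hd]; nlinarith
  have hd2 : d < π / 4 := by rw [hd]; nlinarith
  have ht : d < tan d := lt_tan (by linarith) (by linarith)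
  have ht1 : tan d < 1 := by
    have := tan_lt_tan_of_lt_of_lt_pi_div_two (x := d) (y := π / 4) (by linarith) (by linarith) hd2
    rwa [tan_pi_div_four] at this
  have hs : π * 1.507 / 2 = d - π / 4 + π := by rw [hd]; ring
  have htan : tan (π * 1.507 / 2) = (tan d - 1) / (1 + tan d) := by
    have hc : 0 < cos d := cos_pos_of_mem_Ioo ⟨by linarith, by linarith⟩
    have hsn : 0 < sin d := sin_pos_of_pos_of_lt_pi (by linarith) (by linarith)
    rw [hs, tan_add_pi, tan_eq_sin_div_cos, tan_eq_sin_div_cos, sin_sub, cos_sub]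
    simp only [sin_pi_div_four, cos_pi_div_four]
    have : cos d + sin d ≠ 0 := by positivity
    have h2 : √2 ≠ 0 := by positivity
    field_simp
  have hE : 100 < exp (2 * (π * 1.507 / 2)) := by
    have h1 : (4.7 : ℝ) < 2 * (π * 1.507 / 2) := by linarith
    have h2 : (1 + 0.7 : ℝ) + 0.7 ^ 2 / 2 ≤ exp 0.7 := by
      have := quadratic_le_exp_of_nonneg (x := 0.7) (by norm_num)
      linarith
    have h3 : (2.718 : ℝ) ^ 4 ≤ exp 4 := by
      have : exp 4 = exp 1 ^ 4 := by rw [← exp_nat_mul]; norm_num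
      rw [this]
      have := exp_one_gt_d9
      gcongr
      linarith
    calc (100 : ℝ) < 2.718 ^ 4 * ((1 + 0.7 : ℝ) + 0.7 ^ 2 / 2) := by norm_num
      _ ≤ exp 4 * exp 0.7 := by gcongr
      _ = exp 4.7 := by rw [← exp_add]; norm_num
      _ < _ := exp_lt_exp.2 h1
  have htanh : tanh (π * 1.507 / 2)
      = (exp (2 * (π * 1.507 / 2)) - 1) / (exp (2 * (π * 1.507 / 2)) + 1) := by
    rw [tanh_eq, exp_neg, two_mul, exp_add]
    have := exp_pos (π * 1.507 / 2)
    field_simp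
  rw [htanh, htan]
  set E := exp (2 * (π * 1.507 / 2))
  have : (E - 1) / (E + 1) + (tan d - 1) / (1 + tan d)
      = 2 * (E * tan d - 1) / ((E + 1) * (1 + tan d)) := by
    have : E + 1 ≠ 0 := by positivity
    have : 1 + tan d ≠ 0 := by linarith
    field_simp
    ring
  rw [this]
  have : 1 < E * tan d := by nlinarith
  have : 0 < 1 + tan d := by linarith
  have : 0 < E + 1 := by positivity
  have : 0 < E * tan d - 1 := by linarith
  positivity

open Real in
theorem exists_isLeast_beamRoots :
    ∃ r : ℝ, 1.5 < r ∧ r < 1.507 ∧ IsLeast beamRoots (r ^ 4) := by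
  have hpi := pi_pos
  set h : ℝ → ℝ := fun r => tanh (π * r / 2) + tan (π * r / 2) with hh
  have hcont : ContinuousOn h (Set.Icc 1.5 1.507) := by
    intro r hr
    have hc : cos (π * r / 2) ≠ 0 := by
      apply (cos_neg_of_pi_div_two_lt_of_lt _ _).ne
      · nlinarith [hr.1]
      · nlinarith [hr.2]
    have h1 : ContinuousAt (fun r : ℝ => tan (π * r / 2)) r :=
      ContinuousAt.comp (f := fun r : ℝ => π * r / 2) (continuousAt_tan.2 hc) (by fun_prop)
    have h2 : Continuous (fun r : ℝ => tanh (π * r / 2)) := by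
      simp only [tanh_eq_sinh_div_cosh]
      exact Continuous.div (by fun_prop) (by fun_prop) fun x => (cosh_pos _).ne'
    exact (h2.continuousAt.add h1).continuousWithinAt
  have hl : h 1.5 < 0 := by
    have : tan (π * 1.5 / 2) = -1 := by
      rw [show π * 1.5 / 2 = -(π / 4) + π by ring, tan_add_pi, tan_neg, tan_pi_div_four]
    simp only [hh, this]
    linarith [tanh_lt_one (π * 1.5 / 2)]
  have hr : 0 < h 1.507 := tanh_add_tan_pos_right
  obtain ⟨r, ⟨hr1, hr2⟩, hr0⟩ := intermediate_value_Ioo (by norm_num) hcont ⟨hl, hr⟩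
  have hroot : ∀ x : ℝ, 0 ≤ x → (x ^ 4) ^ (1 / 4 : ℝ) = x := fun x hx => by
    rw [← rpow_natCast, ← rpow_mul hx]; norm_num
  refine ⟨r, hr1, hr2, ⟨by positivity, ?_⟩, ?_⟩
  · rw [hroot r (by linarith)]
    exact hr0
  · rintro t ⟨ht0, ht⟩
    by_contra! hlt
    set q := t ^ (1 / 4 : ℝ) with hq
    have hq0 : 0 < q := by positivity
    have hqt : q ^ 4 = t := by
      rw [hq, ← rpow_natCast, ← rpow_mul ht0.le]; norm_num
    have hqr : q < r := lt_of_pow_lt_pow_left₀ 4 (by linarith) (by rwa [hqt])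
    rcases le_or_gt (π * q / 2) (π / 2) with h1 | h1
    · exact (tanh_add_tan_pos_of_le (by positivity) h1).ne' ht
    · have := strictMonoOn_tanh_add_tan (a := π * q / 2) (b := π * r / 2)
        ⟨h1, by nlinarith⟩ ⟨by nlinarith, by nlinarith⟩ (by nlinarith)
      simp only at this
      rw [ht] at this
      exact this.ne' hr0

open Real in
theorem integral_abs_sin_two_pi : ∫ θ in (0 : ℝ)..2 * π, |sin θ| = 4 := by
  have hi : ∀ a b : ℝ, IntervalIntegrable (fun θ : ℝ => |sin θ|) volume a b :=
    fun a b => (by fun_prop : Continuous fun θ : ℝ => |sin θ|).intervalIntegrable a b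
  have hpi := pi_pos
  rw [← intervalIntegral.integral_add_adjacent_intervals (hi 0 π) (hi π (2 * π))]
  have h1 : ∫ θ in (0 : ℝ)..π, |sin θ| = ∫ θ in (0 : ℝ)..π, sin θ :=
    intervalIntegral.integral_congr fun θ hθ => by
      rw [Set.uIcc_of_le hpi.le] at hθ
      exact abs_of_nonneg (sin_nonneg_of_nonneg_of_le_pi hθ.1 hθ.2)
  have h2 : ∫ θ in π..2 * π, |sin θ| = ∫ θ in π..2 * π, -sin θ :=
    intervalIntegral.integral_congr fun θ hθ => by
      rw [Set.uIcc_of_le (by linarith)] at hθ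
      apply abs_of_nonpos
      have := sin_nonneg_of_nonneg_of_le_pi (x := θ - π) (by linarith [hθ.1]) (by linarith [hθ.2])
      rw [sin_sub_pi] at this
      linarith
  rw [h1, h2, intervalIntegral.integral_neg, integral_sin, integral_sin]
  norm_num

open Real in
theorem circleAverage_const_add_mul_abs_im (A s x : ℝ) {R : ℝ} (hR : 0 < R) :
    circleAverage (fun z : ℂ => A + s * |z.im|) x R = A + s * R * (2 / π) := by
  have him : ∀ θ : ℝ, |(circleMap (x : ℂ) R θ).im| = R * |sin θ| := fun θ => by
    simp [circleMap, abs_mul, abs_of_pos hR, Complex.exp_mul_I, ← Complex.ofReal_sin, ← Complex.ofReal_cos]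
  rw [circleAverage]
  simp only [him]
  have hc : Continuous fun θ : ℝ => s * (R * |sin θ|) := by fun_prop
  rw [intervalIntegral.integral_add (by simp) (hc.intervalIntegrable _ _),
    intervalIntegral.integral_const_mul, intervalIntegral.integral_const_mul,
    integral_abs_sin_two_pi]
  simp
  field_simp
  ring

open MeromorphicOn in
/-- Jensen's inequality, keeping only the double zeros in a given finite set. -/
theorem sum_log_double_zeros_le {g : ℂ → ℂ} (hg : Differentiable ℂ g) {s C : ℝ} (hC : 1 ≤ C)
    (hs : 0 ≤ s) (hb : ∀ z, ‖g z‖ ≤ C * Real.exp (s * |z.im|)) (x : ℝ) {R : ℝ} (hR : 0 < R)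
    (hx : g x ≠ 0) (S : Finset ℂ)
    (hS : ∀ u ∈ S, ‖(x : ℂ) - u‖ ≤ R ∧ g u = 0 ∧ deriv g u = 0) :
    ∑ u ∈ S, 2 * Real.log (R * ‖(x : ℂ) - u‖⁻¹) + Real.log ‖g x‖
      ≤ Real.log C + s * R * (2 / Real.pi) := by
  have han : AnalyticOnNhd ℂ g Set.univ := fun z _ => hg.analyticAt z
  have hanB : AnalyticOnNhd ℂ g (Metric.closedBall (x : ℂ) |R|) := fun z _ => hg.analyticAt z
  have hJ := hanB.circleAverage_log_norm hR.ne' hx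
  have hle : Real.circleAverage (Real.log ‖g ·‖) x R ≤ Real.log C + s * R * (2 / Real.pi) := by
    rw [← circleAverage_const_add_mul_abs_im _ _ _ hR]
    apply Real.circleAverage_mono
    · exact (hanB.mono Metric.sphere_subset_closedBall).meromorphicOn.circleIntegrable_log_norm
    · apply ContinuousOn.circleIntegrable hR.le
      fun_prop
    · intro z _
      rcases eq_or_ne (g z) 0 with h | h
      · have := Real.log_nonneg hC
        simp only [h, norm_zero, Real.log_zero]
        positivity
      · have := Real.log_le_log (norm_pos_iff.2 h) (hb z)
        rwa [Real.log_mul (by linarith) (Real.exp_ne_zero _), Real.log_exp] at this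
  set D := divisor g (Metric.closedBall (x : ℂ) |R|) with hD
  have hnn : ∀ u, 0 ≤ (D u : ℝ) * Real.log (R * ‖(x : ℂ) - u‖⁻¹) := by
    intro u
    by_cases hu : u ∈ Metric.closedBall (x : ℂ) |R|
    · refine mul_nonneg (mod_cast hanB.divisor_nonneg u) ?_
      rcases eq_or_ne ((x : ℂ) - u) 0 with h0 | h0
      · simp [h0]
      · apply Real.log_nonneg
        rw [← div_eq_mul_inv, one_le_div (norm_pos_iff.2 h0)]
        rwa [Metric.mem_closedBall, dist_comm, dist_eq_norm, abs_of_pos hR] at hu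
    · simp [hD, hu]
  have hfin : (Function.support fun u => (D u : ℝ) * Real.log (R * ‖(x : ℂ) - u‖⁻¹)).Finite :=
    (D.finiteSupport (isCompact_closedBall _ _)).subset fun u hu => by
      simp only [Function.mem_support] at hu ⊢
      intro h
      simp [h] at hu
  have hsum : ∑ u ∈ S, 2 * Real.log (R * ‖(x : ℂ) - u‖⁻¹)
      ≤ ∑ᶠ u, (D u : ℝ) * Real.log (R * ‖(x : ℂ) - u‖⁻¹) := by
    classical
    rw [finsum_eq_sum_of_support_subset (s := hfin.toFinset ∪ S) _ (by
      intro u hu; simp only [Finset.coe_union, Set.Finite.coe_toFinset]; exact Or.inl hu)]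
    calc _ ≤ ∑ u ∈ S, (D u : ℝ) * Real.log (R * ‖(x : ℂ) - u‖⁻¹) := ?_
      _ ≤ _ := Finset.sum_le_sum_of_subset_of_nonneg Finset.subset_union_right
        fun u _ _ => hnn u
    apply Finset.sum_le_sum
    intro u hu
    obtain ⟨huR, hu0, hu1⟩ := hS u hu
    have hmem : u ∈ Metric.closedBall (x : ℂ) |R| := by
      rwa [Metric.mem_closedBall, dist_comm, dist_eq_norm, abs_of_pos hR]
    have hux : (x : ℂ) - u ≠ 0 := fun h => hx (by rw [sub_eq_zero.1 h, hu0])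
    have hord : (2 : ℤ) ≤ D u := by
      rw [hD, AnalyticOnNhd.divisor_apply hanB hmem]
      have h2 : ((2 : ℕ) : ℕ∞) ≤ analyticOrderAt g u := by
        rw [natCast_le_analyticOrderAt_iff_iteratedDeriv_eq_zero (hg.analyticAt u)]
        intro i hi
        interval_cases i
        · simpa using hu0
        · simpa using hu1
      have htop : analyticOrderAt g u ≠ ⊤ := by
        intro h
        rw [analyticOrderAt_eq_top] at h
        have := han.eq_of_eventuallyEq (fun z _ => analyticAt_const (v := (0 : ℂ))) h
        exact hx (congrFun this x)
      lift analyticOrderAt g u to ℕ using htop with n hn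
      have : 2 ≤ n := by exact_mod_cast h2
      simpa using this
    have hlog : 0 ≤ Real.log (R * ‖(x : ℂ) - u‖⁻¹) := by
      apply Real.log_nonneg
      rwa [← div_eq_mul_inv, one_le_div (norm_pos_iff.2 hux)]
    have : (2 : ℝ) ≤ D u := by exact_mod_cast hord
    gcongr
  rw [hJ] at hle
  linarith

theorem le_sum_log_div (K : ℕ) (hK : 1 ≤ K) :
    (K : ℝ) - 1 - Real.log K ≤ ∑ j ∈ Finset.range K, Real.log (K / (j + 1)) := by
  induction K, hK using Nat.le_induction with
  | base => simp
  | succ K hK ih =>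
    have hK0 : (0 : ℝ) < K := by exact_mod_cast hK
    have hd : ∀ j : ℕ, Real.log ((K + 1 : ℝ) / (j + 1))
        = Real.log (K / (j + 1)) + (Real.log (K + 1) - Real.log K) := fun j => by
      have : (0 : ℝ) < j + 1 := by positivity
      rw [Real.log_div (by positivity) this.ne', Real.log_div hK0.ne' this.ne']
      ring
    push_cast
    rw [Finset.sum_range_succ, div_self (by positivity), Real.log_one, add_zero]
    simp only [hd]
    rw [Finset.sum_add_distrib, Finset.sum_const, Finset.card_range, nsmul_eq_mul]
    have h1 := Real.one_sub_inv_le_log_of_pos (x := (K + 1 : ℝ) / K) (by positivity)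
    rw [Real.log_div (by positivity) hK0.ne', inv_div] at h1
    have h2 : 1 ≤ (K + 1 : ℝ) * (Real.log (K + 1) - Real.log K) := by
      calc (1 : ℝ) = (K + 1) * (1 - K / (K + 1)) := by field_simp; ring
        _ ≤ _ := by gcongr
    linarith

/-- Double zeros that are dense enough near `x` force `g x` to be small. -/
theorem log_norm_le_of_double_zeros {g : ℂ → ℂ} (hg : Differentiable ℂ g) {s C : ℝ} (hC : 1 ≤ C)
    (hs : 0 ≤ s) (hb : ∀ z, ‖g z‖ ≤ C * Real.exp (s * |z.im|)) {L a : ℝ} (hL : 0 < L)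
    (hz : ∀ x ≥ a, ∃ u : ℝ, x < u ∧ u ≤ x + L ∧ g u = 0 ∧ deriv g u = 0)
    {K : ℕ} (hK : 1 ≤ K) {x : ℝ} (hx : a + K * L ≤ x) (hgx : g x ≠ 0) :
    Real.log ‖g x‖ ≤ Real.log C + s * (K * L) * (2 / Real.pi) - 4 * (K - 1 - Real.log K) := by
  classical
  choose! u hu1 hu2 hu3 hu4 using hz
  have hK0 : (0 : ℝ) < K := by exact_mod_cast hK
  let t : ℕ ⊕ ℕ → ℝ := Sum.elim (fun j => x + j * L) (fun j => x - (j + 1) * L)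
  let I : Finset (ℕ ⊕ ℕ) := (Finset.range K).disjSum (Finset.range K)
  have hta : ∀ i ∈ I, a ≤ t i := by
    rintro (j | j) hj
    · have : 0 ≤ K * L := by positivity
      have : 0 ≤ j * L := by positivity
      simp only [t, Sum.elim_inl]
      linarith
    · have hj' : j < K := by simpa [I] using hj
      have : ((j : ℝ) + 1) * L ≤ K * L := by
        gcongr
        exact_mod_cast hj'
      simp only [t, Sum.elim_inr]
      linarith
  have hstep : ∀ i ∈ I, ∀ j ∈ I, t i < t j → u (t i) < u (t j) := by
    intro i hi j hj hij
    refine (hu2 _ (hta i hi)).trans_lt (lt_of_le_of_lt ?_ (hu1 _ (hta j hj)))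
    have key : ∀ m n : ℤ, x + m * L < x + n * L → x + m * L + L ≤ x + n * L := by
      intro m n h
      have h1 : (m : ℝ) < n := lt_of_mul_lt_mul_right (by linarith) hL.le
      have h2 : (m : ℝ) + 1 ≤ n := by exact_mod_cast h1
      nlinarith
    have hrep : ∀ i, ∃ m : ℤ, t i = x + m * L := by
      rintro (j | j)
      · exact ⟨j, by simp [t]⟩
      · exact ⟨-(j + 1), by simp only [t, Sum.elim_inr]; push_cast; ring⟩
    obtain ⟨m, hm⟩ := hrep i
    obtain ⟨n, hn⟩ := hrep j
    rw [hm, hn] at hij ⊢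
    exact key m n hij
  have htinj : ∀ i j, t i = t j → i = j := by
    rintro (i | i) (j | j) h <;> simp only [t, Sum.elim_inl, Sum.elim_inr] at h
    · have : (i : ℝ) = j := mul_right_cancel₀ hL.ne' (by linarith)
      rw [Nat.cast_injective this]
    · have : 0 ≤ (i : ℝ) * L := by positivity
      have : 0 < ((j : ℝ) + 1) * L := by positivity
      linarith
    · have : 0 ≤ (j : ℝ) * L := by positivity
      have : 0 < ((i : ℝ) + 1) * L := by positivity
      linarith
    · have : (i : ℝ) + 1 = j + 1 := mul_right_cancel₀ hL.ne' (by linarith)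
      rw [Nat.cast_injective (R := ℝ) (by linarith : (i : ℝ) = j)]
  have hinj : Set.InjOn (fun i => ((u (t i) : ℝ) : ℂ)) I := by
    intro i hi j hj h
    have h' : u (t i) = u (t j) := Complex.ofReal_injective h
    rcases lt_trichotomy (t i) (t j) with hlt | heq | hlt
    · exact absurd h' (hstep i hi j hj hlt).ne
    · exact htinj i j heq
    · exact absurd h' (hstep j hj i hi hlt).ne'
  let m : ℕ ⊕ ℕ → ℝ := Sum.elim (fun j => (j : ℝ) + 1) (fun j => (j : ℝ) + 1)
  have hdist : ∀ i ∈ I, ‖(x : ℂ) - u (t i)‖ ≤ m i * L := by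
    intro i hi
    have h1 := hu1 _ (hta i hi)
    have h2 := hu2 _ (hta i hi)
    rw [← Complex.ofReal_sub, Complex.norm_real, Real.norm_eq_abs, abs_le]
    rcases i with j | j
    · simp only [t, m, Sum.elim_inl] at h1 h2 ⊢
      have : 0 ≤ (j : ℝ) * L := by positivity
      constructor <;> linarith
    · simp only [t, m, Sum.elim_inr] at h1 h2 ⊢
      have : 0 ≤ (j : ℝ) * L := by positivity
      constructor <;> linarith
  have hJ := sum_log_double_zeros_le hg hC hs hb x (R := K * L) (by positivity) hgx
    (I.image fun i => ((u (t i) : ℝ) : ℂ)) (by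
      intro w hw
      obtain ⟨i, hi, rfl⟩ := Finset.mem_image.1 hw
      refine ⟨(hdist i hi).trans ?_, hu3 _ (hta i hi), hu4 _ (hta i hi)⟩
      rcases i with j | j
      all_goals
        have hj' : j < K := by simpa [I] using hi
        simp only [m, Sum.elim_inl, Sum.elim_inr]
        gcongr
        exact_mod_cast hj')
  rw [Finset.sum_image hinj] at hJ
  have hlow : ∑ i ∈ I, 2 * Real.log (K / m i)
      ≤ ∑ i ∈ I, 2 * Real.log (K * L * ‖(x : ℂ) - u (t i)‖⁻¹) := by
    apply Finset.sum_le_sum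
    intro i hi
    have hne : (x : ℂ) - u (t i) ≠ 0 := fun h =>
      hgx (by rw [sub_eq_zero.1 h]; exact hu3 _ (hta i hi))
    have hpos := norm_pos_iff.2 hne
    have hd := hdist i hi
    have hq : 0 < m i := by
      rcases i with j | j <;> simp only [m, Sum.elim_inl, Sum.elim_inr] <;> positivity
    gcongr
    rw [← div_eq_mul_inv, div_le_div_iff₀ hq hpos]
    calc _ ≤ (K : ℝ) * (_ * L) := mul_le_mul_of_nonneg_left hd hK0.le
      _ = _ := by ring
  rw [Finset.sum_disjSum] at hlow
  simp only [m, Sum.elim_inl, Sum.elim_inr, ← Finset.mul_sum] at hlow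
  have := le_sum_log_div K hK
  rw [← Finset.mul_sum] at hJ
  linarith

theorem exp_decay_of_double_zeros {g : ℂ → ℂ} (hg : Differentiable ℂ g) {s C : ℝ} (hC : 1 ≤ C)
    (hs : 0 ≤ s) (hb : ∀ z, ‖g z‖ ≤ C * Real.exp (s * |z.im|)) {L a : ℝ} (hL : 0 < L)
    (hsL : s * L < 2 * Real.pi)
    (hz : ∀ x ≥ a, ∃ u : ℝ, x < u ∧ u ≤ x + L ∧ g u = 0 ∧ deriv g u = 0) :
    ∃ c > 0, ∃ M, ∀ x : ℝ, 0 ≤ x → ‖g x‖ ≤ M * Real.exp (-c * x) := by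
  set κ : ℝ := 4 - s * L * (2 / Real.pi) with hκ
  have hpi := Real.pi_pos
  have hκ0 : 0 < κ := by
    have : s * L * (2 / Real.pi) < 2 * Real.pi * (2 / Real.pi) := by gcongr
    have h4 : 2 * Real.pi * (2 / Real.pi) = 4 := by field_simp; norm_num
    linarith
  set c := κ / (2 * L) with hc
  have hc0 : 0 < c := by positivity
  set A := Real.log C - 4 * Real.log (κ / 8) + κ / 2 + c * a with hA
  refine ⟨c, hc0, Real.exp A + C * Real.exp (c * (|a| + L)), fun x hx0 => ?_⟩
  have hC0 : 0 < C := by linarith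
  rw [add_mul]
  rcases lt_or_ge x (a + L) with hxa | hxa
  · have h1 : ‖g x‖ ≤ C := by simpa using hb x
    have h2 : (1 : ℝ) ≤ Real.exp (c * (|a| + L)) * Real.exp (-c * x) := by
      rw [← Real.exp_add, Real.one_le_exp_iff]
      have : x ≤ |a| + L := by linarith [le_abs_self a]
      nlinarith
    calc ‖g x‖ ≤ C * 1 := by linarith
      _ ≤ C * (Real.exp (c * (|a| + L)) * Real.exp (-c * x)) := by gcongr
      _ ≤ _ := by
        rw [← mul_assoc]
        exact le_add_of_nonneg_left (by positivity)
  · rcases eq_or_ne (g x) 0 with h0 | h0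
    · rw [h0, norm_zero]; positivity
    set K := ⌊(x - a) / L⌋₊ with hKdef
    have hq : 1 ≤ (x - a) / L := by rw [one_le_div hL]; linarith
    have hK1 : 1 ≤ K := Nat.le_floor (by exact_mod_cast hq)
    have hKle : (K : ℝ) ≤ (x - a) / L := Nat.floor_le (by linarith)
    have hKlt : (x - a) / L < K + 1 := Nat.lt_floor_add_one _
    have hK0 : (0 : ℝ) < K := by exact_mod_cast hK1
    have h1 := log_norm_le_of_double_zeros hg hC hs hb hL hz hK1
      (by rw [le_div_iff₀ hL] at hKle; linarith) h0
    have h2 := Real.log_le_sub_one_of_pos (x := κ / 8 * K) (by positivity)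
    rw [Real.log_mul (by positivity) (by positivity)] at h2
    have h3 : Real.log ‖g x‖ ≤ A + -c * x := by
      have h4 : κ / 2 * ((x - a) / L) = c * (x - a) := by rw [hc]; field_simp
      have h5 : κ / 2 * ((x - a) / L) ≤ κ / 2 * (K + 1) := by gcongr
      have h6 : s * (K * L) * (2 / Real.pi) = (4 - κ) * K := by rw [hκ]; ring
      rw [h6] at h1
      rw [hA]
      linarith
    have h7 : ‖g x‖ ≤ Real.exp A * Real.exp (-c * x) := by
      rw [← Real.exp_add, ← Real.log_le_iff_le_exp (norm_pos_iff.2 h0)]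
      exact h3
    exact h7.trans (le_add_of_nonneg_right (by positivity))

open Filter Asymptotics in
/-- An entire function of exponential type, bounded on the real line and exponentially decaying
along the positive half-line, vanishes on the real line. -/
theorem eq_zero_of_exp_decay {g : ℂ → ℂ} (hg : Differentiable ℂ g) {s C : ℝ} (hC : 1 ≤ C)
    (hs : 0 ≤ s) (hb : ∀ z, ‖g z‖ ≤ C * Real.exp (s * |z.im|)) {c M : ℝ} (hc : 0 < c)
    (hd : ∀ x : ℝ, 0 ≤ x → ‖g x‖ ≤ M * Real.exp (-c * x)) (x : ℝ) : g x = 0 := by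
  have hpi := Real.pi_pos
  have hC0 : 0 < C := by linarith
  have hM : 0 ≤ M := by simpa using (norm_nonneg _).trans (hd 0 le_rfl)
  let E : ℂ → ℂ := fun w =>
    -s * w - (c / Real.pi : ℝ) * (w * Complex.log (1 + w)) + Complex.I * ((c / 2 : ℝ) * w)
  let G : ℂ → ℂ := fun w => g (Complex.I * w) * Complex.exp (E w)
  have hslit : ∀ w : ℂ, 0 ≤ w.re → 1 + w ∈ Complex.slitPlane := fun w hw =>
    Or.inl (by simp; linarith)
  have hGn : ∀ w, ‖G w‖ = ‖g (Complex.I * w)‖ * Real.exp (E w).re := fun w => by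
    simp [G, Complex.norm_exp]
  have hGb : ∀ w : ℂ, 0 ≤ w.re → ‖G w‖ ≤ C * Real.exp (s * w.re + (E w).re) := fun w hw => by
    rw [hGn, Real.exp_add, ← mul_assoc]
    have := hb (Complex.I * w)
    simp only [Complex.mul_im, Complex.I_re, zero_mul, Complex.I_im, one_mul, zero_add,
      abs_of_nonneg hw] at this
    gcongr
  have hzero : Set.EqOn G 0 {z : ℂ | 0 ≤ z.re} := by
    apply PhragmenLindelof.eq_zero_on_right_half_plane_of_superexponential_decay
    · apply DifferentiableOn.diffContOnCl
      rw [Complex.closure_setOfPred_lt_re]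
      intro w hw
      apply DifferentiableAt.differentiableWithinAt
      have h1 : DifferentiableAt ℂ (fun w : ℂ => Complex.log (1 + w)) w :=
        DifferentiableAt.clog (by fun_prop) (hslit w hw)
      have h2 : DifferentiableAt ℂ (fun w => g (Complex.I * w)) w :=
        (hg _).comp w (by fun_prop)
      have h3 : DifferentiableAt ℂ E w := by
        simp only [E]
        fun_prop
      exact h2.mul h3.cexp
    · refine ⟨3 / 2, by norm_num, s + s + c / Real.pi * (4 + Real.pi) + c / 2,
        IsBigO.of_bound C ?_⟩
      rw [eventually_inf_principal]
      filter_upwards [eventually_cobounded_le_norm (E := ℂ) 1] with w hw1 hw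
      have hw0 : 0 ≤ w.re := le_of_lt hw
      refine (hGb w hw0).trans ?_
      rw [Real.norm_of_nonneg (Real.exp_pos _).le]
      gcongr
      set r := ‖w‖ with hr
      have hr0 : 0 < r := by linarith
      have hrr : r ^ (3 / 2 : ℝ) = r * r ^ (1 / 2 : ℝ) := by
        rw [← Real.rpow_one_add' hr0.le (by norm_num)]; norm_num
      have hhalf : 1 ≤ r ^ (1 / 2 : ℝ) := Real.one_le_rpow hw1 (by norm_num)
      have hlog : ‖Complex.log (1 + w)‖ ≤ (4 + Real.pi) * r ^ (1 / 2 : ℝ) := by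
        have h1 : (1 : ℝ) ≤ ‖1 + w‖ := by
          refine le_trans ?_ (Complex.re_le_norm _)
          simpa using hw0
        have h2 : ‖1 + w‖ ≤ 4 * r := by
          refine (norm_add_le _ _).trans ?_
          rw [norm_one]; linarith
        have h3 : Real.log ‖1 + w‖ ≤ 4 * r ^ (1 / 2 : ℝ) := by
          calc Real.log ‖1 + w‖ ≤ ‖1 + w‖ ^ (1 / 2 : ℝ) / (1 / 2) :=
                Real.log_le_rpow_div (norm_nonneg _) (by norm_num)
            _ ≤ (4 * r) ^ (1 / 2 : ℝ) / (1 / 2) := by gcongr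
            _ = 4 * r ^ (1 / 2 : ℝ) := by
              rw [Real.mul_rpow (by norm_num) hr0.le, show (4 : ℝ) = 2 ^ (2 : ℝ) by norm_num,
                ← Real.rpow_mul (by norm_num)]
              norm_num
              ring
        calc ‖Complex.log (1 + w)‖ ≤ |(Complex.log (1 + w)).re| + |(Complex.log (1 + w)).im| :=
              Complex.norm_le_abs_re_add_abs_im _
          _ ≤ 4 * r ^ (1 / 2 : ℝ) + Real.pi * 1 := by
            rw [Complex.log_re, Complex.log_im, abs_of_nonneg (Real.log_nonneg h1), mul_one]
            exact add_le_add h3 (Complex.abs_arg_le_pi _)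
          _ ≤ _ := by rw [add_mul]; gcongr
      have hE : (E w).re ≤ s * r + c / Real.pi * (r * ((4 + Real.pi) * r ^ (1 / 2 : ℝ)))
          + c / 2 * r := by
        refine (Complex.re_le_norm _).trans ?_
        refine (norm_add_le _ _).trans (add_le_add ((norm_sub_le _ _).trans (add_le_add ?_ ?_)) ?_)
        · simp [abs_of_nonneg hs, hr]
        · rw [norm_mul, norm_mul, Complex.norm_real, Real.norm_of_nonneg (by positivity)]
          gcongr
        · rw [norm_mul, norm_mul, Complex.norm_real, Real.norm_of_nonneg (by positivity),
            Complex.norm_I, one_mul]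
      have hre : w.re ≤ r := Complex.re_le_norm w
      have hle : r ≤ r ^ (3 / 2 : ℝ) := by
        rw [hrr]; exact le_mul_of_one_le_right hr0.le hhalf
      calc s * w.re + (E w).re
          ≤ s * r + (s * r + c / Real.pi * (r * ((4 + Real.pi) * r ^ (1 / 2 : ℝ))) + c / 2 * r) := by
            gcongr
        _ = s * r + s * r + c / Real.pi * (4 + Real.pi) * r ^ (3 / 2 : ℝ) + c / 2 * r := by
            rw [hrr]; ring
        _ ≤ s * r ^ (3 / 2 : ℝ) + s * r ^ (3 / 2 : ℝ)
            + c / Real.pi * (4 + Real.pi) * r ^ (3 / 2 : ℝ) + c / 2 * r ^ (3 / 2 : ℝ) := by gcongr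
        _ = _ := by ring
    · intro n
      have hkey : Tendsto (fun x : ℝ => C * Real.exp (x * (n - c / Real.pi * Real.log (1 + x))))
          atTop (nhds 0) := by
        rw [show (0 : ℝ) = C * 0 by ring]
        refine Tendsto.const_mul _ (Real.tendsto_exp_atBot.comp ?_)
        apply tendsto_id.atTop_mul_atBot₀
        have h1 : Tendsto (fun x : ℝ => Real.log (1 + x)) atTop atTop :=
          Real.tendsto_log_atTop.comp (tendsto_atTop_add_const_left _ _ tendsto_id)
        have h2 := tendsto_neg_atTop_atBot.comp (h1.const_mul_atTop (r := c / Real.pi) (by positivity))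
        simpa [sub_eq_add_neg] using! tendsto_atBot_add_const_left atTop (n : ℝ) h2
      refine squeeze_zero' (Eventually.of_forall fun x => by positivity) ?_ hkey
      filter_upwards [eventually_ge_atTop 0] with x hx
      have hE : (E x).re = -s * x - c / Real.pi * (x * Real.log (1 + x)) := by
        have : Complex.log (1 + x) = (Real.log (1 + x) : ℝ) := by
          rw [Complex.ofReal_log (by linarith)]; push_cast; rfl
        simp only [E, this]
        simp
      have h1 := hGb x (by simpa using hx)
      rw [hE] at h1
      calc Real.exp x ^ n * ‖G x‖ ≤ Real.exp x ^ n * _ := mul_le_mul_of_nonneg_left h1 (by positivity)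
        _ = C * (Real.exp (n * x) * Real.exp (s * (x : ℂ).re
            + (-s * x - c / Real.pi * (x * Real.log (1 + x))))) := by
          rw [Real.exp_nat_mul]; ring
        _ = _ := by
          rw [← Real.exp_add, Complex.ofReal_re]
          ring_nf
    · refine ⟨max C M, fun y => ?_⟩
      have hE : (E (y * Complex.I)).re = c / Real.pi * (y * (1 + y * Complex.I).arg) - c / 2 * y := by
        simp only [E, Complex.add_re, Complex.sub_re, Complex.mul_re, Complex.mul_im,
          Complex.log_re, Complex.log_im, Complex.ofReal_re, Complex.ofReal_im, Complex.I_re,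
          Complex.I_im, Complex.neg_re, Complex.neg_im]
        ring
      have harg : |(1 + y * Complex.I : ℂ).arg| ≤ Real.pi / 2 := by
        rw [Complex.abs_arg_le_pi_div_two_iff]; simp
      have h1 : y * (1 + y * Complex.I : ℂ).arg ≤ |y| * (Real.pi / 2) := by
        refine (le_abs_self _).trans ?_
        rw [abs_mul]
        gcongr
      have h2 : (E (y * Complex.I)).re ≤ c / 2 * |y| - c / 2 * y := by
        rw [hE]
        calc _ ≤ c / Real.pi * (|y| * (Real.pi / 2)) - c / 2 * y := by gcongr
          _ = _ := by field_simp
      have h3 : Complex.I * (y * Complex.I) = ((-y : ℝ) : ℂ) := by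
        push_cast
        linear_combination (y : ℂ) * Complex.I_mul_I
      rw [hGn, h3]
      rcases le_total 0 y with hy | hy
      · rw [abs_of_nonneg hy, sub_self] at h2
        calc _ ≤ C * 1 := by
              gcongr
              · simpa using hb ((-y : ℝ) : ℂ)
              · exact Real.exp_le_one_iff.2 h2
          _ ≤ _ := by rw [mul_one]; exact le_max_left _ _
      · rw [abs_of_nonpos hy] at h2
        calc _ ≤ M * Real.exp (-c * -y) * Real.exp (c / 2 * -y - c / 2 * y) := by
              gcongr
              exact hd (-y) (by linarith)
          _ = M := by
            rw [mul_assoc, ← Real.exp_add]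
            ring_nf
            simp
          _ ≤ _ := le_max_right _ _
  have h := hzero (x := -x * Complex.I) (by simp)
  have h3 : Complex.I * (-x * Complex.I) = x := by
    linear_combination -(x : ℂ) * Complex.I_mul_I
  simp only [G, h3, Pi.zero_apply] at h
  exact (mul_eq_zero.1 h).resolve_right (Complex.exp_ne_zero _)

theorem fourier_ae_eq_zero_of_mem_bandLimited {σ : ℝ} {F : Lp ℂ 2 (volume : Measure ℝ)}
    (hF : F ∈ bandLimited σ) :
    ∀ᵐ ξ : ℝ, ξ ∉ Set.Icc (-(σ / (2 * Real.pi))) (σ / (2 * Real.pi)) →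
      (𝓕 F : Lp ℂ 2 (volume : Measure ℝ)) ξ = 0 := by
  have h2 : (0 : ℝ) < 2 * Real.pi := by positivity
  have hq : Measure.QuasiMeasurePreserving (fun ξ : ℝ => 2 * Real.pi * ξ) volume volume := by
    refine ⟨by fun_prop, ?_⟩
    rw [Real.map_volume_mul_left h2.ne']
    exact Measure.smul_absolutelyContinuous
  filter_upwards [hq.ae hF] with ξ hξ hmem
  rw [angularFourier, mul_div_cancel_left₀ _ h2.ne'] at hξ
  apply hξ
  intro h
  apply hmem
  rw [Set.mem_Icc, ← neg_div, div_le_iff₀ h2, le_div_iff₀ h2]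
  constructor <;> linarith [h.1, h.2]

/-- A square-integrable function with integrable Fourier transform is given by Fourier inversion. -/
theorem ae_eq_fourierInv_of_integrable_fourier (F : Lp ℂ 2 (volume : Measure ℝ))
    (hi : Integrable (𝓕 F : Lp ℂ 2 (volume : Measure ℝ))) :
    F =ᵐ[volume] 𝓕⁻ ((𝓕 F : Lp ℂ 2 (volume : Measure ℝ)) : ℝ → ℂ) := by
  set φ : Lp ℂ 2 (volume : Measure ℝ) := 𝓕 F with hφ
  have hcont : Continuous (𝓕⁻ (φ : ℝ → ℂ)) := by
    rw [Real.fourierInv_eq_fourier_comp_neg]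
    exact VectorFourier.fourierIntegral_continuous Real.continuous_fourierChar
      (by fun_prop) hi.comp_neg
  refine ae_eq_of_integral_contDiff_smul_eq ((Lp.memLp F).locallyIntegrable one_le_two)
    hcont.locallyIntegrable fun ψ hψ hψc => ?_
  let Ψ : SchwartzMap ℝ ℂ := HasCompactSupport.toSchwartzMap (f := fun x => (ψ x : ℂ))
    (hψc.comp_left (g := fun r : ℝ => (r : ℂ)) Complex.ofReal_zero)
    (Complex.ofRealCLM.contDiff.comp hψ)
  have hΨ : ∀ x, Ψ x = (ψ x : ℂ) := fun x => rfl
  have h1 : F = 𝓕⁻ φ := (FourierTransform.fourierInv_fourier_eq F).symm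
  have h2 := DFunLike.congr_fun (Lp.fourierInv_toTemperedDistribution_eq φ) Ψ
  rw [← h1, TemperedDistribution.fourierInv_apply, Lp.toTemperedDistribution_apply,
    Lp.toTemperedDistribution_apply] at h2
  have h3 : ∫ ξ, (𝓕⁻ Ψ) ξ • φ ξ = ∫ x, Ψ x • 𝓕⁻ (φ : ℝ → ℂ) x := by
    have hself := VectorFourier.integral_fourierIntegral_smul_eq_flip (L := innerₗ ℝ)
      Real.continuous_fourierChar continuous_inner (Ψ.integrable (μ := volume)) hi.comp_neg
    rw [← integral_neg_eq_self]
    calc ∫ ξ, (𝓕⁻ Ψ) (-ξ) • φ (-ξ) = ∫ ξ, 𝓕 (Ψ : ℝ → ℂ) ξ • φ (-ξ) := by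
          simp only [SchwartzMap.fourierInv_coe, Real.fourierInv_eq_fourier_neg, neg_neg]
      _ = ∫ x, Ψ x • 𝓕 (fun ξ => φ (-ξ)) x := by
          simpa using! hself
      _ = _ := by rw [Real.fourierInv_eq_fourier_comp_neg]
  rw [h3] at h2
  simpa [hΨ] using h2.symm

/-- Band-limited functions extend to entire functions of exponential type, bounded on the line. -/
theorem exists_entire_of_mem_bandLimited {σ : ℝ} (hσ : 0 < σ) {F : Lp ℂ 2 (volume : Measure ℝ)}
    (hF : F ∈ bandLimited σ) :
    ∃ (g : ℂ → ℂ) (C : ℝ), Differentiable ℂ g ∧ 1 ≤ C ∧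
      (∀ z, ‖g z‖ ≤ C * Real.exp (σ * |z.im|)) ∧ F =ᵐ[volume] fun x : ℝ => g x := by
  set φ : Lp ℂ 2 (volume : Measure ℝ) := 𝓕 F with hφ
  set b := σ / (2 * Real.pi) with hb
  have hpi := Real.pi_pos
  have hb0 : 0 < b := by positivity
  have hbσ : 2 * Real.pi * b = σ := by rw [hb]; field_simp
  have hsupp := fourier_ae_eq_zero_of_mem_bandLimited hF
  set ν := (volume : Measure ℝ).restrict (Set.Icc (-b) b) with hν
  have hind : φ =ᵐ[volume] (Set.Icc (-b) b).indicator φ := by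
    filter_upwards [hsupp] with ξ hξ
    by_cases h : ξ ∈ Set.Icc (-b) b
    · rw [Set.indicator_of_mem h]
    · rw [Set.indicator_of_notMem h]; exact hξ h
  have hφν : Integrable φ ν := ((Lp.memLp φ).restrict _).integrable one_le_two
  have hφi : Integrable φ :=
    ((integrable_indicator_iff measurableSet_Icc).2 hφν).congr hind.symm
  let e : ℂ → ℝ → ℂ := fun z ξ => Complex.exp (2 * Real.pi * Complex.I * z * ξ)
  have hen : ∀ z, ∀ ξ ∈ Set.Icc (-b) b, ‖e z ξ‖ ≤ Real.exp (σ * |z.im|) := by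
    intro z ξ hξ
    have hre : (2 * Real.pi * Complex.I * z * ξ).re = -(2 * Real.pi * z.im * ξ) := by
      simp [Complex.mul_re, Complex.mul_im]
    rw [Complex.norm_exp, hre]
    gcongr
    refine (neg_le_abs _).trans ?_
    rw [abs_mul, abs_mul, abs_of_pos (by positivity : 0 < 2 * Real.pi), ← hbσ]
    have : |ξ| ≤ b := abs_le.2 hξ
    calc 2 * Real.pi * |z.im| * |ξ| ≤ 2 * Real.pi * |z.im| * b := by gcongr
      _ = _ := by ring
  have hmeas : ∀ z, AEStronglyMeasurable (fun ξ => e z ξ * φ ξ) ν := fun z =>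
    (by fun_prop : Continuous (e z)).aestronglyMeasurable.mul hφν.1
  have hint : ∀ z, Integrable (fun ξ => e z ξ * φ ξ) ν := fun z =>
    hφν.bdd_mul (by fun_prop : Continuous (e z)).aestronglyMeasurable
      ((ae_restrict_mem measurableSet_Icc).mono fun ξ hξ => hen z ξ hξ)
  refine ⟨fun z => ∫ ξ, e z ξ * φ ξ ∂ν, (∫ ξ, ‖φ ξ‖ ∂ν) + 1, ?_, ?_, ?_, ?_⟩
  · intro z
    refine (hasDerivAt_integral_of_dominated_loc_of_deriv_le (𝕜 := ℂ) (μ := ν)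
      (F := fun z ξ => e z ξ * φ ξ)
      (F' := fun z ξ => e z ξ * (2 * Real.pi * Complex.I * ξ) * φ ξ) (x₀ := z)
      (bound := fun ξ => Real.exp (σ * (|z.im| + 1)) * (2 * Real.pi * b) * ‖φ ξ‖)
      (Metric.ball_mem_nhds z one_pos)
      (Filter.Eventually.of_forall hmeas) (hint z) ?_ ?_ ?_ ?_).2.differentiableAt
    · exact (by fun_prop : Continuous fun ξ => e z ξ * (2 * Real.pi * Complex.I * ξ)).aestronglyMeasurable.mul hφν.1
    · filter_upwards [ae_restrict_mem measurableSet_Icc] with ξ hξ w hw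
      rw [norm_mul, norm_mul]
      have h1 : |w.im| ≤ |z.im| + 1 := by
        have h2 : |(w - z).im| ≤ ‖w - z‖ := Complex.abs_im_le_norm _
        rw [Metric.mem_ball, dist_eq_norm] at hw
        rw [Complex.sub_im] at h2
        linarith [abs_sub_abs_le_abs_sub w.im z.im]
      have h3 : ‖(2 * Real.pi * Complex.I * ξ : ℂ)‖ ≤ 2 * Real.pi * b := by
        simp only [norm_mul, Complex.norm_real, Complex.norm_I, Real.norm_eq_abs, abs_of_pos hpi,
          Complex.norm_ofNat, mul_one]
        have : |ξ| ≤ b := abs_le.2 hξ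
        gcongr
      have h4 : ‖e w ξ‖ ≤ Real.exp (σ * (|z.im| + 1)) := (hen w ξ hξ).trans (by gcongr)
      gcongr
    · exact hφν.norm.const_mul _
    · refine Filter.Eventually.of_forall fun ξ w _ => ?_
      have h1 : HasDerivAt (fun w : ℂ => 2 * Real.pi * Complex.I * w * ξ)
          (2 * Real.pi * Complex.I * ξ) w := by
        simpa using ((hasDerivAt_id w).const_mul (2 * Real.pi * Complex.I : ℂ)).mul_const (ξ : ℂ)
      exact (h1.cexp).mul_const _
  · have : 0 ≤ ∫ ξ, ‖φ ξ‖ ∂ν := integral_nonneg fun _ => norm_nonneg _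
    linarith
  · intro z
    calc ‖∫ ξ, e z ξ * φ ξ ∂ν‖ ≤ ∫ ξ, Real.exp (σ * |z.im|) * ‖φ ξ‖ ∂ν := by
          refine norm_integral_le_of_norm_le (hφν.norm.const_mul _) ?_
          filter_upwards [ae_restrict_mem measurableSet_Icc] with ξ hξ
          rw [norm_mul]
          gcongr
          exact hen z ξ hξ
      _ = (∫ ξ, ‖φ ξ‖ ∂ν) * Real.exp (σ * |z.im|) := by rw [integral_const_mul, mul_comm]
      _ ≤ _ := by gcongr; linarith
  · filter_upwards [ae_eq_fourierInv_of_integrable_fourier F hφi] with x hx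
    rw [hx, Real.fourierInv_eq', ← hφ, ← integral_indicator measurableSet_Icc]
    apply integral_congr_ae
    filter_upwards [hind] with ξ hξ
    rw [hξ]
    by_cases h : ξ ∈ Set.Icc (-b) b
    · simp only [Set.indicator_of_mem h, smul_eq_mul, e]
      congr 2
      simp
      ring
    · simp [Set.indicator_of_notMem h]

theorem exists_mem_Ioc_of_gaps_le {Z : Set ℝ} {L : ℝ} (hfin : ∀ p q, (Z ∩ Set.Icc p q).Finite)
    (hgap : ∀ a b, AreConsecutive Z a b → b - a ≤ L) {p : ℝ} (hp : p ∈ Z) (hub : ¬ BddAbove Z)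
    {x : ℝ} (hx : p ≤ x) : ∃ u ∈ Z, x < u ∧ u ≤ x + L := by
  obtain ⟨q, hqZ, hq⟩ := not_bddAbove_iff.1 hub x
  obtain ⟨a, ⟨haZ, ha⟩, hamax⟩ :=
    (hfin p x).exists_maximalFor id _ ⟨p, hp, le_rfl, hx⟩
  have hfin' : (Z ∩ Set.Ioc x q).Finite :=
    (hfin x q).subset (Set.inter_subset_inter_right _ Set.Ioc_subset_Icc_self)
  obtain ⟨b, ⟨hbZ, hb⟩, hbmin⟩ := hfin'.exists_minimalFor id _ ⟨q, hqZ, hq, le_rfl⟩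
  refine ⟨b, hbZ, hb.1, ?_⟩
  have := hgap a b ⟨haZ, hbZ, ha.2.trans_lt hb.1, fun y hy hlt => ?_⟩
  · linarith [ha.2]
  · rcases le_or_gt y x with h | h
    · exact hlt.1.not_ge (hamax ⟨hy, ha.1.trans hlt.1.le, h⟩ hlt.1.le)
    · exact hlt.2.not_ge (hbmin ⟨hy, h, hlt.2.le.trans hb.2⟩ hlt.2.le)

theorem finite_zeros_inter_Icc {g : ℂ → ℂ} (hg : Differentiable ℂ g) {x₀ : ℝ} (hx₀ : g x₀ ≠ 0)
    (p q : ℝ) : ({x : ℝ | g x = 0 ∧ deriv g x = 0} ∩ Set.Icc p q).Finite := by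
  by_contra hinf
  obtain ⟨y, -, hy⟩ := Set.Infinite.exists_accPt_of_subset_isCompact hinf
    (isCompact_Icc (a := p) (b := q)) Set.inter_subset_right
  have han : AnalyticOnNhd ℝ (fun x : ℝ => g x) Set.univ := fun x _ =>
    ((hg.analyticAt x).restrictScalars (𝕜 := ℝ)).comp (Complex.ofRealCLM.analyticAt x)
  have hfr : ∃ᶠ x : ℝ in nhdsWithin y {y}ᶜ, g x = 0 :=
    (accPt_iff_frequently_nhdsNE.1 hy).mono fun x hx => hx.1.1
  exact hx₀ (congrFun (han.eq_of_frequently_eq (fun x _ => analyticAt_const (v := (0 : ℂ))) hfr) x₀)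

theorem not_all_gaps_le_of_not_bddAbove {g : ℂ → ℂ} (hg : Differentiable ℂ g) {s C L : ℝ}
    (hC : 1 ≤ C) (hs : 0 ≤ s) (hb : ∀ z, ‖g z‖ ≤ C * Real.exp (s * |z.im|)) (hL : 0 < L)
    (hsL : s * L < 2 * Real.pi) {x₀ : ℝ} (hx₀ : g x₀ ≠ 0)
    (hub : ¬ BddAbove {x : ℝ | g x = 0 ∧ deriv g x = 0}) :
    ∃ a b, AreConsecutive {x : ℝ | g x = 0 ∧ deriv g x = 0} a b ∧ L < b - a := by
  by_contra! hgap
  obtain ⟨p, hp, -⟩ := not_bddAbove_iff.1 hub 0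
  obtain ⟨c, hc, M, hd⟩ := exp_decay_of_double_zeros hg hC hs hb hL hsL (a := p) fun x hx => by
    obtain ⟨u, hu, h1, h2⟩ :=
      exists_mem_Ioc_of_gaps_le (finite_zeros_inter_Icc hg hx₀) hgap hp hub hx
    exact ⟨u, h1, h2, hu.1, hu.2⟩
  exact hx₀ (eq_zero_of_exp_decay hg hC hs hb hc hd x₀)

/-- The double zeros of an entire function of exponential type `s`, bounded on the real line,
cannot all have gaps at most `L < 2π / s`. -/
theorem exists_large_gap {g : ℂ → ℂ} (hg : Differentiable ℂ g) {s C L : ℝ}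
    (hC : 1 ≤ C) (hs : 0 ≤ s) (hb : ∀ z, ‖g z‖ ≤ C * Real.exp (s * |z.im|)) (hL : 0 < L)
    (hsL : s * L < 2 * Real.pi) {x₀ : ℝ} (hx₀ : g x₀ ≠ 0)
    (hinf : {x : ℝ | g x = 0 ∧ deriv g x = 0}.Infinite) :
    ∃ a b, AreConsecutive {x : ℝ | g x = 0 ∧ deriv g x = 0} a b ∧ L < b - a := by
  by_cases hub : BddAbove {x : ℝ | g x = 0 ∧ deriv g x = 0}
  · have hlb : ¬ BddBelow {x : ℝ | g x = 0 ∧ deriv g x = 0} := fun ⟨p, hp⟩ => by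
      obtain ⟨q, hq⟩ := hub
      exact hinf ((finite_zeros_inter_Icc hg hx₀ p q).subset fun x hx => ⟨hx, hp hx, hq hx⟩)
    have hmem : ∀ x : ℝ, x ∈ {x : ℝ | g (-x) = 0 ∧ deriv (fun z => g (-z)) x = 0} ↔
        -x ∈ {x : ℝ | g x = 0 ∧ deriv g x = 0} := fun x => by
      simp [deriv_comp_neg]
    obtain ⟨a, b, ⟨ha, hbZ, hab, hcons⟩, hlt⟩ :=
      not_all_gaps_le_of_not_bddAbove (g := fun z => g (-z)) (hg.comp differentiable_neg) hC hs
        (fun z => by simpa using hb (-z)) hL hsL (x₀ := -x₀) (by simpa using hx₀) (by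
          rintro ⟨q, hq⟩
          refine hlb ⟨-q, fun x hx => ?_⟩
          have := hq ((hmem (-x)).2 (by rwa [neg_neg]))
          linarith)
    refine ⟨-b, -a, ⟨(hmem b).1 hbZ, (hmem a).1 ha, by linarith, fun y hy h => ?_⟩, by linarith⟩
    exact hcons (-y) ((hmem (-y)).2 (by rwa [neg_neg])) ⟨by linarith [h.2], by linarith [h.1]⟩
  · exact not_all_gaps_le_of_not_bddAbove hg hC hs hb hL hsL hx₀ hub

theorem theorem2p1 :
    ∃ τ : ℝ, IsLeast beamRoots τ ∧ |τ - 5.0625| < 1 / 10 ∧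
      ∀ (σ : ℝ), 0 < σ →
      ∀ (F : Lp ℂ 2 (volume : Measure ℝ)), F ∈ bandLimited σ → F ≠ 0 →
      -- `f` is the continuous representative of the class `F`
      ∀ (f : ℝ → ℂ), Continuous f → f =ᵐ[volume] F →
        (doubleZeros f).Infinite →
        ∃ a b : ℝ, AreConsecutive (doubleZeros f) a b ∧
          Real.pi / σ * τ ^ (1 / 4 : ℝ) < b - a := by
  obtain ⟨r, hr1, hr2, hleast⟩ := exists_isLeast_beamRoots
  have hpi := Real.pi_pos
  refine ⟨r ^ 4, hleast, ?_, ?_⟩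
  · have h1 : (1.5 : ℝ) ^ 4 < r ^ 4 := by gcongr
    have h2 : r ^ 4 < (1.507 : ℝ) ^ 4 := by gcongr
    rw [abs_lt]
    constructor <;> norm_num at * <;> linarith
  intro σ hσ F hF hF0 f hf hfF hinf
  have hroot : (r ^ 4 : ℝ) ^ (1 / 4 : ℝ) = r := by
    rw [← Real.rpow_natCast, ← Real.rpow_mul (by linarith)]; norm_num
  rw [hroot]
  obtain ⟨g, C, hg, hC, hb, hFg⟩ := exists_entire_of_mem_bandLimited hσ hF
  have hfg : f = fun x : ℝ => g x :=
    (Continuous.ae_eq_iff_eq volume hf (hg.continuous.comp Complex.continuous_ofReal)).1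
      (hfF.trans hFg)
  have hZ : doubleZeros f = {x : ℝ | g x = 0 ∧ deriv g x = 0} := by
    ext x
    have hd : HasDerivAt f (deriv g x) x := by
      rw [hfg]; exact (hg x).hasDerivAt.comp_ofReal
    simp only [doubleZeros, Set.mem_ofPred_eq]
    refine and_congr (by rw [hfg]) ⟨fun h => hd.unique h, fun h => h ▸ hd⟩
  obtain ⟨x₀, hx₀⟩ : ∃ x₀ : ℝ, g x₀ ≠ 0 := by
    by_contra! h
    refine hF0 ((Lp.eq_zero_iff_ae_eq_zero).2 ?_)
    filter_upwards [hFg] with x hx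
    rw [hx, h x]; rfl
  rw [hZ] at hinf ⊢
  refine exists_large_gap hg hC hσ.le hb (by positivity) ?_ hx₀ hinf
  rw [← mul_assoc, mul_div_cancel₀ _ hσ.ne']
  nlinarith
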